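/- Let $p\ge 7$ be a prime, $k$ an algebraically closed field of characteristic $p$, and $a,b\in k$ such that $f_{a,b}(x)=x^{10}+x^7+ax^4+bx$ is separable. Let $H_{a,b}$ be the smooth projective (hyperelliptic, genus $4$) curve over $k$ with function field $K=\operatorname{Frac}\bigl(k[x,y]/(y^2-f_{a,b}(x))\bigr)$. Then the differentials $\omega_j=\frac{x^{j-1}}{y}dx$ ($1\le j\le 4$) form a basis of $H^0(H_{a,b},\Omega^1)$, and the Cartier operator $\mathscr C$ on $H^0(H_{a,b},\Omega^1)$, given by $\mathscr C(d\phi+\eta^p x^{p-1}dx)=\eta\,dx$ for $\phi,\eta\in K$, is well defined. Let $M_{a,b}=(m_{ij})_{1\le i,j\le 4}$ be the Cartier–Manin matrix of $H_{a,b}$ with respect to this basis, i.e. the matrix with $\mathscr C(\omega_j)=\sum_{i=1}^{4} m_{ij}^{1/p}\,\omega_i$ for $1\le j\le 4$, and let $c_n$ denote the coefficient of $x^n$ in $f_{a,b}(x)^{(p-1)/2}$. (1) If $p\equiv 1\pmod 3$, then $$M_{a,b}=\begin{pmatrix} c_{p-1}&0&0&c_{p-4}\\ 0&c_{2p-2}&0&0\\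 0&0&c_{3p-3}&0\\ c_{4p-1}&0&0&c_{4p-4}\end{pmatrix}.$$ (2) If $p\equiv 2\pmod 3$, then $$M_{a,b}=\begin{pmatrix} 0&0&c_{p-3}&0\\ 0&c_{2p-2}&0&0\\ c_{3p-1}&0&0&c_{3p-4}\\ 0&0&c_{4p-3}&0\end{pmatrix}.$$ -/

import Mathlib

open Polynomial
open scoped KaehlerDifferential

namespace HyperellipticCurve

noncomputable section

section FunctionField

variable (k : Type*) {K : Type*} [Field k] [Field K] [Algebra k K]

/-- The differentials `∑ aᵢ duᵢ` (`aᵢ, uᵢ ∈ A`) of `K/k`, where `A` is the integral closure of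
`k[t]` in `K`.  If `t ∈ K` is nonconstant, `Spec A` is the affine open part of the smooth
projective model of `K/k` where the function `t` has no pole, and these are the differentials that
are regular on it (the image of `Ω[A⁄k]` in `Ω[K⁄k]`). -/
def differentialsRegularOn (t : K) : Submodule k (Ω[K⁄k]) :=
  Submodule.span k {ω | ∃ a u : K, IsIntegral (Algebra.adjoin k {t}) a ∧
    IsIntegral (Algebra.adjoin k {t}) u ∧ ω = a • KaehlerDifferential.D k K u}

/-- The space `H⁰(C, Ω¹)` of regular differential forms on the smooth projective curve `C` over `k`
with function field `K`, where `x ∈ K` is nonconstant.  The curve `C` (the normalization of `ℙ¹`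
in `K` through `x`) is covered by the two affine opens `x ≠ ∞` and `x⁻¹ ≠ ∞`. -/
def regularDifferentials (x : K) : Submodule k (Ω[K⁄k]) :=
  differentialsRegularOn k x ⊓ differentialsRegularOn k x⁻¹

variable {k}

/-- `ω = dφ + η ^ p x ^ (p - 1) dx` for some `φ, η ∈ K`, and `ω' = η dx`. -/
def IsCartierImage (p : ℕ) (x : K) (ω ω' : Ω[K⁄k]) : Prop :=
  ∃ φ η : K,
    ω = KaehlerDifferential.D k K φ + (η ^ p * x ^ (p - 1)) • KaehlerDifferential.D k K x ∧
    ω' = η • KaehlerDifferential.D k K x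

/-- The (modified) Cartier operator on `H⁰(C, Ω¹)`: it sends `ω = dφ + η ^ p x ^ (p - 1) dx` to
`η dx`. -/
def cartierOperator (p : ℕ) (x : K) (ω : regularDifferentials k x) : regularDifferentials k x :=
  Classical.epsilon fun ω' : regularDifferentials k x => IsCartierImage p x (ω : Ω[K⁄k]) ω'

/-- The Cartier-Manin matrix with respect to a basis `ω₁, …, ω_g` of `H⁰(C, Ω¹)`.
The Cartier operator `𝒞` is `p⁻¹`-linear, and the matrix `M` is normalized by
`𝒞 ω_j = ∑ i, (M i j) ^ (1/p) • ω_i`: its entries are the `p`-th powers of the coordinates. -/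
def cartierManinMatrix {g : ℕ} (p : ℕ) (x : K)
    (A : Module.Basis (Fin g) k (regularDifferentials k x)) : Matrix (Fin g) (Fin g) k :=
  Matrix.of fun i j => (A.repr (cartierOperator p x (A j)) i) ^ p

end FunctionField

section Curve

variable {k : Type*} [Field k]

/-- The coordinate ring `k[x, y] / (y ^ 2 - f(x))`. -/
abbrev CoordinateRing (f : k[X]) : Type _ := AdjoinRoot (X ^ 2 - C f : k[X][X])

/-- `y ^ 2 - f(x)` is irreducible for separable nonconstant `f`, so the coordinate ring has a
field of fractions. -/
theorem coordinateRing_isDomain (f : k[X]) (hf : f.Separable) (hd : f.natDegree ≠ 0) :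
    IsDomain (CoordinateRing f) := by
  have hm : (X ^ 2 - C f : k[X][X]).Monic := monic_X_pow_sub_C f two_ne_zero
  have hdeg : (X ^ 2 - C f : k[X][X]).natDegree = 2 := natDegree_X_pow_sub_C
  have hirr : Irreducible (X ^ 2 - C f : k[X][X]) := by
    rw [hm.irreducible_iff_roots_eq_zero_of_degree_le_three hdeg.ge (by omega)]
    refine Multiset.eq_zero_of_forall_notMem fun r hr => hd ?_
    have h0 : r ^ 2 = f := by
      have := (mem_roots'.1 hr).2
      simpa [IsRoot, sub_eq_zero] using this
    have hu : IsUnit r := hf.squarefree r ⟨1, by rw [← h0]; ring⟩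
    rw [← h0]
    exact natDegree_eq_zero_of_isUnit (hu.pow 2)
  exact AdjoinRoot.isDomain_of_prime hirr.prime

variable (f : k[X]) (K : Type*) [Field K] [Algebra (CoordinateRing f) K]

/-- The function `x` on the curve `y ^ 2 = f(x)`. -/
def xFun : K := algebraMap (CoordinateRing f) K (AdjoinRoot.of _ X)

/-- The function `y` on the curve `y ^ 2 = f(x)`. -/
def yFun : K := algebraMap (CoordinateRing f) K (AdjoinRoot.root _)

/-- The polynomial `f_{a,b} = x ^ 10 + x ^ 7 + a x ^ 4 + b x`. -/
def fab (a b : k) : k[X] := X ^ 10 + X ^ 7 + C a * X ^ 4 + C b * X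

end Curve

end

end HyperellipticCurve

namespace HyperellipticCurve

/-! On `K` one has `dx/y = (1/y)^p f^((p-1)/2) dx`, since `y^(p-1) = f^((p-1)/2)`. Factors that are
`p`-th powers are constants for `d`, so the Cartier image of `x^j dx/y` depends only on the
polynomial `f^((p-1)/2) x^j`. Monomials `x^n` with `p ∤ n+1` integrate, and those with `n =
p(i+1)-1` yield the matrix entries (`isCartierImage_pow_div`). The Cartier image is unique because
`x^(p-1) dx` is not exact (`derivation_ne_neg_pow`).

The zeros come from `f_{a,b} = x g(x^3)`: the polynomial `f^m` only has monomials `x^n` with `n ≡ m`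
mod 3 (`coeff_fab_pow_eq_zero`).

The basis of regular differentials is found by comparing the affine chart with the chart at
infinity, where `1/x` and `y/x^5` satisfy the reciprocal equation. `IsQuadraticModel` isolates what
both charts share, so the same lemmas serve each of them (`mem_regularDifferentials_iff`). -/

open IntermediateField in
/-- `K` is the quadratic extension of `k(t)` given by `y ^ 2 = f(t)`, and `σ` is the hyperelliptic
involution. -/
structure IsQuadraticModel {k K : Type*} [Field k] [Field K] [Algebra k K]
    (f : k[X]) (t y : K) (σ : K →ₐ[k] K) : Prop where
  transcendental : Transcendental k t
  sq_eq : y ^ 2 = aeval t f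
  map_t : σ t = t
  map_y : σ y = -y
  exists_eq (u : K) : ∃ r s : K, r ∈ k⟮t⟯ ∧ s ∈ k⟮t⟯ ∧ u = r + s * y

theorem mem_adjoin_singleton_iff {k K : Type*} [Field k] [Field K] [Algebra k K] {t u : K} :
    u ∈ Algebra.adjoin k {t} ↔ ∃ P : k[X], u = aeval t P := by
  rw [Algebra.adjoin_singleton_eq_range_aeval, AlgHom.mem_range]
  simp only [eq_comm]

/-! ### Integrality over `k[t]` inside `k(t)` -/

section Rational

open IntermediateField

variable {k K : Type*} [Field k] [Field K] [Algebra k K] {t : K}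

theorem aeval_ne_zero_of_transcendental (ht : Transcendental k t) {P : k[X]} (hP : P ≠ 0) :
    aeval t P ≠ 0 := fun h => hP (transcendental_iff.1 ht P h)

open scoped IntermediateField.algebraAdjoinAdjoin in
/-- An element of `k(t)` that is integral over `k[t]` lies in `k[t]`. -/
theorem exists_aeval_of_isIntegral (ht : Transcendental k t) {r : K} (hr : r ∈ k⟮t⟯)
    (hi : IsIntegral (Algebra.adjoin k {t}) r) : ∃ P : k[X], r = aeval t P := by
  let e : k[X] ≃ₐ[k] Algebra.adjoin k {t} :=
    (AlgEquiv.ofInjective (aeval t) (transcendental_iff_injective.1 ht)).trans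
      (Subalgebra.equivOfEq _ _ (Algebra.adjoin_singleton_eq_range_aeval k t).symm)
  have : IsIntegrallyClosed (Algebra.adjoin k {t}) :=
    IsIntegrallyClosed.of_equiv e.toRingEquiv
  have hi' : IsIntegral (Algebra.adjoin k {t}) (⟨r, hr⟩ : k⟮t⟯) := by
    obtain ⟨q, hq, h0⟩ := hi
    refine ⟨q, hq, Subtype.ext ?_⟩
    have h1 := hom_eval₂ q (algebraMap (Algebra.adjoin k {t}) k⟮t⟯) (algebraMap k⟮t⟯ K) ⟨r, hr⟩
    refine h1.trans (Eq.trans ?_ h0)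
    congr 1
  obtain ⟨z, hz⟩ := IsIntegrallyClosed.isIntegral_iff.1 hi'
  obtain ⟨P, hP⟩ := mem_adjoin_singleton_iff.1 z.2
  exact ⟨P, by rw [← hP]; exact (congrArg Subtype.val hz).symm⟩

theorem exists_coprime_eq_div (ht : Transcendental k t) {s : K} (hs : s ∈ k⟮t⟯) :
    ∃ P Q : k[X], IsCoprime P Q ∧ Q ≠ 0 ∧ s = aeval t P / aeval t Q := by
  obtain ⟨P, Q, rfl⟩ := (mem_adjoin_simple_iff k s).1 hs
  by_cases hQ : Q = 0
  · exact ⟨0, 1, isCoprime_one_right, one_ne_zero, by simp [hQ]⟩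
  obtain ⟨P', Q', c, hcop, rfl, rfl⟩ :=
    UniqueFactorizationMonoid.exists_reduced_factors' P Q hQ
  refine ⟨P', Q', hcop.isCoprime, right_ne_zero_of_mul hQ, ?_⟩
  rw [map_mul, map_mul, mul_div_mul_left]
  exact aeval_ne_zero_of_transcendental ht (left_ne_zero_of_mul hQ)

/-- If `s ∈ k(t)` and `s ^ 2 f(t)` is a polynomial in `t`, with `f` squarefree, then so is `s`. -/
theorem exists_aeval_of_sq_mul (ht : Transcendental k t) {f : k[X]} (hf : Squarefree f) {s : K}
    (hs : s ∈ k⟮t⟯) {q : k[X]} (h : s ^ 2 * aeval t f = aeval t q) :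
    ∃ P : k[X], s = aeval t P := by
  obtain ⟨P, Q, hcop, hQ, rfl⟩ := exists_coprime_eq_div ht hs
  have hQt := aeval_ne_zero_of_transcendental ht hQ
  have h2 : P ^ 2 * f = q * Q ^ 2 := by
    apply transcendental_iff_injective.1 ht
    rw [map_mul, map_mul, map_pow, map_pow, ← h, div_pow]
    field_simp
  have h3 : Q ^ 2 ∣ f :=
    (hcop.symm.pow (m := 2) (n := 2)).dvd_of_dvd_mul_left (Dvd.intro_left _ h2.symm)
  obtain ⟨c, hc, hcQ⟩ := isUnit_iff.1 (hf Q (by rwa [sq] at h3))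
  refine ⟨P * C c⁻¹, ?_⟩
  rw [← hcQ, map_mul, aeval_C, aeval_C, map_inv₀, div_eq_mul_inv]

end Rational

/-! ### Integral closure and differentials on one affine chart -/

namespace IsQuadraticModel

open IntermediateField

variable {k K : Type*} [Field k] [Field K] [Algebra k K]
  {f : k[X]} {t y : K} {σ : K →ₐ[k] K}

theorem map_aeval_t (h : IsQuadraticModel f t y σ) (P : k[X]) :
    σ (aeval t P) = aeval t P := by
  rw [← aeval_algHom_apply, h.map_t]

theorem map_of_mem (h : IsQuadraticModel f t y σ) {r : K} (hr : r ∈ k⟮t⟯) : σ r = r := by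
  obtain ⟨P, Q, rfl⟩ := (mem_adjoin_simple_iff k r).1 hr
  rw [map_div₀, h.map_aeval_t, h.map_aeval_t]

theorem isIntegral_y (h : IsQuadraticModel f t y σ) : IsIntegral (Algebra.adjoin k {t}) y := by
  refine IsIntegral.of_pow (n := 2) two_pos ?_
  rw [h.sq_eq]
  exact isIntegral_algebraMap (R := Algebra.adjoin k {t})
    (x := ⟨aeval t f, mem_adjoin_singleton_iff.2 ⟨f, rfl⟩⟩)

theorem isIntegral_aeval (t : K) (P : k[X]) : IsIntegral (Algebra.adjoin k {t}) (aeval t P) :=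
  isIntegral_algebraMap (R := Algebra.adjoin k {t})
    (x := ⟨aeval t P, mem_adjoin_singleton_iff.2 ⟨P, rfl⟩⟩)

theorem isIntegral_map (h : IsQuadraticModel f t y σ) {u : K}
    (hu : IsIntegral (Algebra.adjoin k {t}) u) : IsIntegral (Algebra.adjoin k {t}) (σ u) := by
  obtain ⟨q, hq, h0⟩ := hu
  refine ⟨q, hq, ?_⟩
  have h1 := hom_eval₂ q (algebraMap (Algebra.adjoin k {t}) K) (σ : K →+* K) u
  rw [h0, map_zero] at h1
  rw [h1]
  change _ = eval₂ _ (σ u) q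
  congr 1
  ext z
  obtain ⟨P, hP⟩ := mem_adjoin_singleton_iff.1 z.2
  change (z : K) = σ (z : K)
  rw [hP, h.map_aeval_t]

/-- The integral closure of `k[t]` in `K` is `k[t] + k[t] y` when `f` is squarefree. -/
theorem isIntegral_iff (h : IsQuadraticModel f t y σ) (h2 : (2 : k) ≠ 0) (hf : Squarefree f)
    (u : K) : IsIntegral (Algebra.adjoin k {t}) u ↔
      ∃ P Q : k[X], u = aeval t P + aeval t Q * y := by
  constructor
  · intro hu
    obtain ⟨r, s, hr, hs, rfl⟩ := h.exists_eq u
    -- `r` is half the trace of `u = r + s y`, and `s^2 f = (u - r)^2`; hence both are integral over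
    -- `k[t]`.
    have h2r : r = aeval t (C (2⁻¹ : k)) * ((r + s * y) + σ (r + s * y)) := by
      rw [map_add, map_mul, h.map_of_mem hr, h.map_of_mem hs, h.map_y, aeval_C]
      have : algebraMap k K 2⁻¹ * 2 = 1 := by
        rw [← map_ofNat (algebraMap k K) 2, ← map_mul, inv_mul_cancel₀ h2, map_one]
      linear_combination (-r) * this
    have hri : IsIntegral (Algebra.adjoin k {t}) r := by
      rw [h2r]
      exact (isIntegral_aeval _ _).mul (hu.add (h.isIntegral_map hu))
    have hsi : IsIntegral (Algebra.adjoin k {t}) (s ^ 2 * aeval t f) := by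
      have : s ^ 2 * aeval t f = ((r + s * y) - r) ^ 2 := by rw [← h.sq_eq]; ring
      rw [this]
      exact (hu.sub hri).pow 2
    obtain ⟨P, hP⟩ := exists_aeval_of_isIntegral h.transcendental hr hri
    obtain ⟨q, hq⟩ := exists_aeval_of_isIntegral h.transcendental
      (mul_mem (pow_mem hs 2) ((mem_adjoin_simple_iff k _).2 ⟨f, 1, by simp⟩)) hsi
    obtain ⟨Q, hQ⟩ := exists_aeval_of_sq_mul h.transcendental hf hs hq
    exact ⟨P, Q, by rw [hP, hQ]⟩
  · rintro ⟨P, Q, rfl⟩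
    exact (isIntegral_aeval _ _).add ((isIntegral_aeval _ _).mul h.isIntegral_y)

theorem y_ne_zero (h : IsQuadraticModel f t y σ) (hf : f ≠ 0) : y ≠ 0 := by
  intro h0
  have := h.sq_eq
  rw [h0, zero_pow two_ne_zero] at this
  exact aeval_ne_zero_of_transcendental h.transcendental hf this.symm

/-- `2 y dy = f'(t) dt`. -/
theorem two_y_smul_D_y (h : IsQuadraticModel f t y σ) :
    (2 * y) • KaehlerDifferential.D k K y =
      aeval t (derivative f) • KaehlerDifferential.D k K t := by
  rw [← Derivation.map_aeval, ← h.sq_eq, Derivation.leibniz_pow]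
  simp [mul_smul, ofNat_smul_eq_nsmul]

/-- When `f` is separable, the differentials regular where `t` is finite are `k[t, y] dt / y`. -/
theorem mem_differentialsRegularOn_iff (h : IsQuadraticModel f t y σ) (h2 : (2 : k) ≠ 0)
    (hf : f.Separable) (ω : Ω[K⁄k]) :
    ω ∈ differentialsRegularOn k t ↔
      ∃ P Q : k[X], ω = ((aeval t P + aeval t Q * y) / y) • KaehlerDifferential.D k K t := by
  have hy : y ≠ 0 := h.y_ne_zero hf.ne_zero
  have h2K : (2 : K) ≠ 0 := by
    rw [← map_ofNat (algebraMap k K) 2]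
    exact (_root_.map_ne_zero _).2 h2
  have hDy : KaehlerDifferential.D k K y =
      (aeval t (derivative f) / (2 * y)) • KaehlerDifferential.D k K t := by
    rw [div_eq_inv_mul, mul_smul, ← h.two_y_smul_D_y, smul_smul,
      inv_mul_cancel₀ (mul_ne_zero h2K hy), one_smul]
  constructor
  · intro hω
    refine Submodule.span_induction ?_ ?_ ?_ ?_ hω
    · rintro _ ⟨a, u, ha, hu, rfl⟩
      obtain ⟨P, Q, rfl⟩ := (h.isIntegral_iff h2 hf.squarefree a).1 ha
      obtain ⟨R, S, rfl⟩ := (h.isIntegral_iff h2 hf.squarefree u).1 hu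
      have hhalf : aeval t (C (2⁻¹ : k)) = (2⁻¹ : K) := by
        rw [aeval_C, map_inv₀, map_ofNat]
      -- With `dy = f' dt / (2y)`, one gets `d(R + S y) = (T + R' y) dt / y`. Multiplying by `P + Q
      -- y` and using `y^2 = f` gives the witnesses.
      let T : k[X] := derivative S * f + C 2⁻¹ * (S * derivative f)
      refine ⟨P * T + Q * derivative R * f, P * derivative R + Q * T, ?_⟩
      rw [map_add, Derivation.leibniz, Derivation.map_aeval, Derivation.map_aeval, hDy,
        smul_smul, smul_smul, ← add_smul, ← add_smul, smul_smul]
      congr 1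
      simp only [T, map_add, map_mul, hhalf, ← h.sq_eq]
      field_simp
      ring
    · exact ⟨0, 0, by simp⟩
    · rintro _ _ _ _ ⟨P, Q, rfl⟩ ⟨R, S, rfl⟩
      refine ⟨P + R, Q + S, ?_⟩
      rw [← add_smul]
      congr 1
      simp only [map_add]
      ring
    · rintro a _ _ ⟨P, Q, rfl⟩
      refine ⟨C a * P, C a * Q, ?_⟩
      rw [algebra_compatible_smul K a, smul_smul]
      congr 1
      simp only [map_mul, aeval_C]
      ring
  · rintro ⟨P, Q, rfl⟩
    obtain ⟨U, V, hUV⟩ := (separable_def f).1 hf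
    -- The Bézout relation `U f + V f' = 1` gives `dt/y = U y dt + 2 V dy`, which has integral
    -- coefficients.
    have key : ((aeval t P + aeval t Q * y) / y) • KaehlerDifferential.D k K t =
        ((aeval t P + aeval t Q * y) * (aeval t U * y)) • KaehlerDifferential.D k K t +
        ((aeval t P + aeval t Q * y) * (aeval t (2 * V))) • KaehlerDifferential.D k K y := by
      rw [hDy, smul_smul, ← add_smul]
      congr 1
      have hUV' := congrArg (aeval t) hUV
      simp only [map_add, map_mul, ← h.sq_eq, map_one] at hUV'
      simp only [map_mul, map_ofNat]
      field_simp
      linear_combination (-(aeval t P + aeval t Q * y)) * hUV'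
    rw [key]
    have hPQ : IsIntegral (Algebra.adjoin k {t}) (aeval t P + aeval t Q * y) :=
      (h.isIntegral_iff h2 hf.squarefree _).2 ⟨P, Q, rfl⟩
    refine add_mem (Submodule.subset_span ⟨_, _, ?_, ?_, rfl⟩)
      (Submodule.subset_span ⟨_, _, ?_, ?_, rfl⟩)
    · exact hPQ.mul ((isIntegral_aeval _ _).mul h.isIntegral_y)
    · simpa using isIntegral_aeval t (X : k[X])
    · exact hPQ.mul (isIntegral_aeval _ _)
    · exact h.isIntegral_y

/-- `Ω[K⁄k]` is spanned by `dt`. -/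
theorem exists_smul_D (h : IsQuadraticModel f t y σ) (h2 : (2 : k) ≠ 0) (hf : f ≠ 0)
    (ω : Ω[K⁄k]) : ∃ u : K, ω = u • KaehlerDifferential.D k K t := by
  have hy : y ≠ 0 := h.y_ne_zero hf
  have h2K : (2 : K) ≠ 0 := by
    rw [← map_ofNat (algebraMap k K) 2]
    exact (_root_.map_ne_zero _).2 h2
  let N : Submodule K (Ω[K⁄k]) := Submodule.span K {KaehlerDifferential.D k K t}
  have hrat : ∀ r ∈ k⟮t⟯, KaehlerDifferential.D k K r ∈ N := by
    intro r hr
    obtain ⟨P, Q, rfl⟩ := (mem_adjoin_simple_iff k r).1 hr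
    rw [div_eq_mul_inv, Derivation.leibniz, Derivation.leibniz_inv, Derivation.map_aeval,
      Derivation.map_aeval]
    have ht : KaehlerDifferential.D k K t ∈ N := Submodule.mem_span_singleton_self _
    exact add_mem (N.smul_mem _ (N.smul_mem _ (N.smul_mem _ ht))) (N.smul_mem _ (N.smul_mem _ ht))
  have hyN : KaehlerDifferential.D k K y ∈ N := by
    have := h.two_y_smul_D_y
    rw [← eq_inv_smul_iff₀ (mul_ne_zero h2K hy)] at this
    rw [this]
    exact N.smul_mem _ (N.smul_mem _ (Submodule.mem_span_singleton_self _))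
  have hN : N = ⊤ := by
    rw [eq_top_iff, ← KaehlerDifferential.span_range_derivation, Submodule.span_le]
    rintro _ ⟨u, rfl⟩
    obtain ⟨r, s, hr, hs, rfl⟩ := h.exists_eq u
    rw [map_add, Derivation.leibniz]
    exact add_mem (hrat r hr) (add_mem (N.smul_mem _ hyN) (N.smul_mem _ (hrat s hs)))
  obtain ⟨u, hu⟩ := Submodule.mem_span_singleton.1 (hN ▸ Submodule.mem_top : ω ∈ N)
  exact ⟨u, hu.symm⟩

/-- If `dt = 0`, then `Ω[K⁄k] = 0`, so `K/k` is formally unramified. Being essentially of finite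
type, it would then be algebraic, against the transcendence of `t`. -/
theorem D_ne_zero (h : IsQuadraticModel f t y σ) (h2 : (2 : k) ≠ 0) (hf : f ≠ 0)
    [Algebra.EssFiniteType k K] : KaehlerDifferential.D k K t ≠ 0 := by
  intro h0
  have : Algebra.FormallyUnramified k K := ⟨⟨fun a b => by
    obtain ⟨u, rfl⟩ := h.exists_smul_D h2 hf a
    obtain ⟨v, rfl⟩ := h.exists_smul_D h2 hf b
    rw [h0, smul_zero, smul_zero]⟩⟩
  have := Algebra.FormallyUnramified.isSeparable k K
  exact h.transcendental (Algebra.IsAlgebraic.isAlgebraic t)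

end IsQuadraticModel

/-! ### The function field as a quadratic model -/

section Model

open IntermediateField

variable {k : Type*} [Field k]

theorem CoordinateRing.exists_eq (f : k[X]) (α : CoordinateRing f) :
    ∃ P Q : k[X], α = AdjoinRoot.of _ P + AdjoinRoot.of _ Q * AdjoinRoot.root _ := by
  obtain ⟨p, rfl⟩ := AdjoinRoot.mk_surjective α
  have hm : (X ^ 2 - C f : k[X][X]).Monic := monic_X_pow_sub_C f two_ne_zero
  have hdeg : (X ^ 2 - C f : k[X][X]).natDegree = 2 := natDegree_X_pow_sub_C
  have hlt : (p %ₘ (X ^ 2 - C f)).natDegree ≤ 1 := by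
    have := natDegree_modByMonic_lt p hm (by intro h; rw [h, natDegree_one] at hdeg; omega)
    omega
  obtain ⟨Q, P, h⟩ := exists_eq_X_add_C_of_natDegree_le_one hlt
  refine ⟨P, Q, ?_⟩
  have h1 : AdjoinRoot.mk (X ^ 2 - C f) p = AdjoinRoot.mk (X ^ 2 - C f) (C Q * X + C P) := by
    rw [← h]
    conv_lhs => rw [← modByMonic_add_div p (X ^ 2 - C f)]
    simp
  rw [h1, map_add, map_mul, AdjoinRoot.mk_C, AdjoinRoot.mk_C, AdjoinRoot.mk_X, add_comm]

theorem CoordinateRing.root_sq (f : k[X]) :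
    (AdjoinRoot.root (X ^ 2 - C f : k[X][X])) ^ 2 = AdjoinRoot.of _ f := by
  have := AdjoinRoot.eval₂_root (X ^ 2 - C f : k[X][X])
  rw [eval₂_sub, eval₂_pow, eval₂_X, eval₂_C] at this
  exact sub_eq_zero.1 this

/-- The hyperelliptic involution `y ↦ -y` of the coordinate ring. -/
noncomputable def CoordinateRing.involution (f : k[X]) :
    CoordinateRing f →ₐ[k] CoordinateRing f :=
  AdjoinRoot.liftAlgHom _ (Algebra.algHom k k[X] (CoordinateRing f)) (-AdjoinRoot.root _) (by
    have h : ((Algebra.algHom k k[X] (CoordinateRing f) : k[X] →ₐ[k] CoordinateRing f) :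
      k[X] →+* CoordinateRing f) = AdjoinRoot.of _ := rfl
    rw [h, eval₂_sub, eval₂_pow, eval₂_X, eval₂_C, neg_sq, CoordinateRing.root_sq, sub_self])

theorem CoordinateRing.involution_of (f P : k[X]) :
    involution f (AdjoinRoot.of _ P) = AdjoinRoot.of _ P :=
  AdjoinRoot.liftAlgHom_of _ _ _ _ _

theorem CoordinateRing.involution_root (f : k[X]) :
    involution f (AdjoinRoot.root _) = -AdjoinRoot.root _ :=
  AdjoinRoot.liftAlgHom_root _ _ _ _

theorem CoordinateRing.involution_involution (f : k[X]) (α : CoordinateRing f) :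
    involution f (involution f α) = α := by
  obtain ⟨P, Q, rfl⟩ := exists_eq f α
  simp only [map_add, map_mul, involution_of, involution_root, map_neg, neg_neg]

variable (f : k[X]) (K : Type*) [Field K] [Algebra k K] [Algebra (CoordinateRing f) K]
  [IsScalarTower k (CoordinateRing f) K]

theorem algebraMap_of_eq_aeval (P : k[X]) :
    algebraMap (CoordinateRing f) K (AdjoinRoot.of _ P) = aeval (xFun f K) P := by
  let φ : k[X] →ₐ[k] K := (IsScalarTower.toAlgHom k (CoordinateRing f) K).comp
    (Algebra.algHom k k[X] (CoordinateRing f))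
  exact (aeval_algHom_apply φ X P ▸ by rw [aeval_X_left_apply] : aeval (φ X) P = φ P).symm

theorem yFun_sq : yFun f K ^ 2 = aeval (xFun f K) f := by
  rw [yFun, ← map_pow, CoordinateRing.root_sq, algebraMap_of_eq_aeval]

variable [IsFractionRing (CoordinateRing f) K]

theorem transcendental_xFun : Transcendental k (xFun f K) := by
  rw [transcendental_iff_injective]
  have hinj : Function.Injective (AdjoinRoot.of (X ^ 2 - C f : k[X][X])) := by
    apply AdjoinRoot.of.injective_of_degree_ne_zero
    rw [degree_X_pow_sub_C two_pos]
    decide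
  intro P Q hPQ
  rw [← algebraMap_of_eq_aeval, ← algebraMap_of_eq_aeval] at hPQ
  exact hinj (IsFractionRing.injective (CoordinateRing f) K hPQ)

theorem essFiniteType {k : Type*} [Field k] (f : k[X]) (K : Type*) [Field K] [Algebra k K]
    [Algebra (CoordinateRing f) K] [IsScalarTower k (CoordinateRing f) K]
    [IsFractionRing (CoordinateRing f) K] : Algebra.EssFiniteType k K := by
  have : Algebra.EssFiniteType (CoordinateRing f) K :=
    Algebra.EssFiniteType.of_isLocalization K (nonZeroDivisors (CoordinateRing f))
  have : Algebra.FiniteType k (CoordinateRing f) :=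
    Algebra.FiniteType.trans (S := k[X]) inferInstance inferInstance
  exact Algebra.EssFiniteType.comp k (CoordinateRing f) K

theorem exists_isQuadraticModel :
    ∃ σ : K →ₐ[k] K, IsQuadraticModel f (xFun f K) (yFun f K) σ := by
  have hinj := IsFractionRing.injective (CoordinateRing f) K
  let g : CoordinateRing f →ₐ[k] K :=
    (IsScalarTower.toAlgHom k (CoordinateRing f) K).comp (CoordinateRing.involution f)
  have hg : Function.Injective g :=
    hinj.comp (Function.LeftInverse.injective (CoordinateRing.involution_involution f))
  let σ : K →ₐ[k] K := IsFractionRing.liftAlgHom hg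
  have hσ (α : CoordinateRing f) : σ (algebraMap _ K α) =
      algebraMap _ K (CoordinateRing.involution f α) := IsFractionRing.lift_algebraMap hg α
  refine ⟨σ, transcendental_xFun f K, yFun_sq f K, ?_, ?_, fun u => ?_⟩
  · rw [xFun, hσ, CoordinateRing.involution_of]
  · rw [yFun, hσ, CoordinateRing.involution_root, map_neg]
  · have hd : IsDomain (CoordinateRing f) := hinj.isDomain _
    have hmem (P : k[X]) : aeval (xFun f K) P ∈ k⟮xFun f K⟯ :=
      (mem_adjoin_simple_iff k _).2 ⟨P, 1, by simp⟩
    obtain ⟨α, β, hβ, rfl⟩ := IsFractionRing.div_surjective (A := CoordinateRing f) u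
    have hβ0 : β ≠ 0 := nonZeroDivisors.ne_zero hβ
    have hβ1 : CoordinateRing.involution f β ≠ 0 := fun h => hβ0 <| by
      rw [← CoordinateRing.involution_involution f β, h, map_zero]
    have hprod := (map_ne_zero_iff _ hinj).2 (mul_ne_zero hβ0 hβ1)
    obtain ⟨P, Q, rfl⟩ := CoordinateRing.exists_eq f α
    obtain ⟨R, S, rfl⟩ := CoordinateRing.exists_eq f β
    have hβK := (map_ne_zero_iff _ hinj).2 hβ0
    have hsq := yFun_sq f K
    simp only [map_add, map_mul, map_neg, CoordinateRing.involution_of,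
      CoordinateRing.involution_root, algebraMap_of_eq_aeval, ← yFun.eq_def] at hprod hβK ⊢
    set x := xFun f K
    set y := yFun f K
    -- The product of the denominator and its conjugate is a norm in `k[x]`, so multiplying by the
    -- conjugate makes the denominator rational in `x`.
    have hN : (aeval x R + aeval x S * y) * (aeval x R + aeval x S * -y) =
        aeval x (R ^ 2 - S ^ 2 * f) := by
      simp only [map_sub, map_mul, map_pow]
      linear_combination (-(aeval x S) ^ 2) * hsq
    rw [hN] at hprod
    refine ⟨aeval x (P * R - Q * S * f) / aeval x (R ^ 2 - S ^ 2 * f),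
      aeval x (Q * R - P * S) / aeval x (R ^ 2 - S ^ 2 * f),
      div_mem (hmem _) (hmem _), div_mem (hmem _) (hmem _), ?_⟩
    rw [div_mul_eq_mul_div, ← add_div, div_eq_div_iff hβK hprod, ← hN]
    simp only [map_sub, map_mul, ← hsq]
    ring

end Model

/-! ### Gluing the two charts: regular differentials -/

/-- The chart at infinity: `t⁻¹` and `y / t ^ (g + 1)` satisfy the reciprocal equation. -/
theorem IsQuadraticModel.inv {k K : Type*} [Field k] [Field K] [Algebra k K] {f h : k[X]}
    {t y : K} {σ : K →ₐ[k] K} (hm : IsQuadraticModel f t y σ) (n : ℕ)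
    (hfh : aeval t f = t ^ (2 * n) * aeval t⁻¹ h) :
    IsQuadraticModel h t⁻¹ (y / t ^ n) σ := by
  have ht : t ≠ 0 := fun h0 => hm.transcendental (h0 ▸ isAlgebraic_zero)
  refine ⟨fun h => hm.transcendental (by simpa using h.inv), ?_, ?_, ?_, fun u => ?_⟩
  · rw [div_pow, hm.sq_eq, hfh, pow_mul', div_eq_iff (pow_ne_zero _ (pow_ne_zero _ ht)), mul_comm]
  · rw [map_inv₀, hm.map_t]
  · rw [map_div₀, map_pow, hm.map_t, hm.map_y, neg_div]
  · obtain ⟨r, s, hr, hs, rfl⟩ := hm.exists_eq u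
    have hle : IntermediateField.adjoin k {t} ≤ IntermediateField.adjoin k {t⁻¹} := by
      rw [IntermediateField.adjoin_simple_le_iff]
      simpa using inv_mem (IntermediateField.mem_adjoin_simple_self k t⁻¹)
    have htm := hle (IntermediateField.mem_adjoin_simple_self k t)
    refine ⟨r, s * t ^ n, hle hr, mul_mem (hle hs) (pow_mem htm n), ?_⟩
    field_simp

namespace IsQuadraticModel

variable {k K : Type*} [Field k] [Field K] [Algebra k K]
  {f h : k[X]} {t y : K} {σ : K →ₐ[k] K}

theorem t_ne_zero (hm : IsQuadraticModel f t y σ) : t ≠ 0 :=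
  fun h0 => hm.transcendental (h0 ▸ isAlgebraic_zero)

theorem aeval_inv_mul_pow_natDegree {t : K} (ht : t ≠ 0) (R : k[X]) :
    aeval t⁻¹ R * t ^ R.natDegree = aeval t R.reverse := by
  let _ : Invertible t⁻¹ := invertibleOfNonzero (inv_ne_zero ht)
  have := eval₂_reverse_mul_pow (algebraMap k K) t⁻¹ R
  rw [invOf_eq_inv, inv_inv] at this
  rw [aeval_def, ← this, aeval_def, mul_assoc, ← mul_pow, inv_mul_cancel₀ ht, one_pow, mul_one]

/-- Pole orders at infinity are compared: a polynomial in `t⁻¹` times `t ^ n` has a pole of order at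
most `n` there. Reversing `R` turns this into a degree count in `k[X]`. -/
theorem natDegree_add_le_of_mul_pow_eq (hm : IsQuadraticModel f t y σ) {P R : k[X]} (hP : P ≠ 0)
    {m n : ℕ} (h : aeval t P * t ^ m = aeval t⁻¹ R * t ^ n) : P.natDegree + m ≤ n := by
  have h1 : P * X ^ (m + R.natDegree) = R.reverse * X ^ n := by
    apply transcendental_iff_injective.1 hm.transcendental
    simp only [map_mul, map_pow, aeval_X, ← aeval_inv_mul_pow_natDegree hm.t_ne_zero]
    rw [pow_add, ← mul_assoc, h]
    ring
  have hR : R.reverse ≠ 0 := by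
    intro h0
    rw [h0, zero_mul] at h1
    exact mul_ne_zero hP (pow_ne_zero _ X_ne_zero) h1
  have h2 := congrArg natDegree h1
  rw [natDegree_mul_X_pow _ hP, natDegree_mul_X_pow _ hR] at h2
  have := reverse_natDegree_le R
  omega

/-- On a hyperelliptic curve of genus `g` the regular differentials are the forms `P(t) dt / y`
with `deg P < g`. -/
theorem mem_regularDifferentials_iff (hm : IsQuadraticModel f t y σ) (h2 : (2 : k) ≠ 0)
    (hf : f.Separable) (hh : h.Separable) [Algebra.EssFiniteType k K] {g : ℕ} (hg : 0 < g)
    (hfh : aeval t f = t ^ (2 * (g + 1)) * aeval t⁻¹ h) (ω : Ω[K⁄k]) :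
    ω ∈ regularDifferentials k t ↔
      ∃ P : k[X], P.natDegree < g ∧ ω = (aeval t P / y) • KaehlerDifferential.D k K t := by
  have hm' := hm.inv (g + 1) hfh
  have ht := hm.t_ne_zero
  have hy : y ≠ 0 := hm.y_ne_zero hf.ne_zero
  have h2K : (2 : K) ≠ 0 := by
    rw [← map_ofNat (algebraMap k K) 2]
    exact (_root_.map_ne_zero _).2 h2
  have hD := hm.D_ne_zero h2 hf.ne_zero
  rw [regularDifferentials, Submodule.mem_inf, hm.mem_differentialsRegularOn_iff h2 hf,
    hm'.mem_differentialsRegularOn_iff h2 hh]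
  simp only [Derivation.leibniz_inv, smul_smul]
  constructor
  · rintro ⟨⟨P, Q, rfl⟩, R, S, hRS⟩
    have h1 := smul_left_injective K hD hRS
    have h3 : (aeval t P + aeval t Q * y) * t ^ 2 =
        -(aeval t⁻¹ R * t ^ (g + 1) + aeval t⁻¹ S * y) := by
      rw [div_eq_iff hy] at h1
      rw [h1]
      generalize aeval t⁻¹ R = u
      generalize aeval t⁻¹ S = v
      field_simp
    -- Adding and subtracting the conjugate of `h3` separates its even and odd parts in `y`. The
    -- even part bounds `deg P + 2` by `g + 1`; the odd part would bound `deg Q + 2` by `0`, so `Q =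
    -- 0`.
    have h4 := congrArg σ h3
    simp only [map_add, map_mul, map_neg, map_pow, hm.map_aeval_t, hm'.map_aeval_t, hm.map_t,
      hm.map_y] at h4
    have hP : aeval t P * t ^ 2 = aeval t⁻¹ (-R) * t ^ (g + 1) := by
      rw [map_neg]
      apply mul_left_cancel₀ h2K
      linear_combination h3 + h4
    have hQ : aeval t Q * t ^ 2 = aeval t⁻¹ (-S) * t ^ 0 := by
      rw [map_neg]
      apply mul_left_cancel₀ (mul_ne_zero h2K hy)
      linear_combination h3 - h4
    have hQ0 : Q = 0 := by
      by_contra hQ0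
      have := hm.natDegree_add_le_of_mul_pow_eq hQ0 hQ
      omega
    refine ⟨P, ?_, by rw [hQ0, map_zero, zero_mul, add_zero]⟩
    by_cases hP0 : P = 0
    · simpa [hP0] using hg
    · have := hm.natDegree_add_le_of_mul_pow_eq hP0 hP
      omega
  · rintro ⟨P, hP, rfl⟩
    -- For `s = t⁻¹` and `w = y / t^(g+1)`, the relation `dt = -s⁻² ds` turns `P(t) dt/y` into
    -- `-P.reverse(s) s^(g-1-deg P) ds/w`, with a nonnegative exponent because `deg P < g`.
    refine ⟨⟨P, 0, by simp⟩, -(P.reverse * X ^ (g - 1 - P.natDegree)), 0, ?_⟩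
    congr 1
    have h1 := aeval_inv_mul_pow_natDegree (inv_ne_zero ht) P
    rw [inv_inv] at h1
    obtain ⟨m, rfl⟩ : ∃ m, g = P.natDegree + m + 1 := ⟨g - 1 - P.natDegree, by omega⟩
    have h5 : P.natDegree + m + 1 - 1 - P.natDegree = m := by omega
    rw [h5, map_neg, map_mul, ← h1, map_pow, aeval_X, map_zero, inv_pow, inv_pow]
    field_simp
    ring

/-- The forms `t ^ j dt / y`, `0 ≤ j < g`, are a basis of the regular differentials on a
hyperelliptic curve of genus `g`. -/
theorem exists_basis (hm : IsQuadraticModel f t y σ) (h2 : (2 : k) ≠ 0)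
    (hf : f.Separable) (hh : h.Separable) [Algebra.EssFiniteType k K] {g : ℕ} (hg : 0 < g)
    (hfh : aeval t f = t ^ (2 * (g + 1)) * aeval t⁻¹ h) :
    ∃ A : Module.Basis (Fin g) k (regularDifferentials k t),
      ∀ j, (A j : Ω[K⁄k]) = (t ^ (j : ℕ) / y) • KaehlerDifferential.D k K t := by
  have hmem := hm.mem_regularDifferentials_iff h2 hf hh hg hfh
  have hy : y ≠ 0 := hm.y_ne_zero hf.ne_zero
  have hD := hm.D_ne_zero h2 hf.ne_zero
  let v (j : Fin g) : regularDifferentials k t :=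
    ⟨(t ^ (j : ℕ) / y) • KaehlerDifferential.D k K t,
      (hmem _).2 ⟨X ^ (j : ℕ), by simp, by simp⟩⟩
  have hli : LinearIndependent k v := by
    rw [Fintype.linearIndependent_iff]
    intro c hc j
    have h1 := congrArg Subtype.val hc
    have h3 : (aeval t (∑ i, C (c i) * X ^ (i : ℕ)) / y) • KaehlerDifferential.D k K t = 0 := by
      rw [← Submodule.coe_zero (p := regularDifferentials k t), ← h1, Submodule.coe_sum,
        map_sum, Finset.sum_div, Finset.sum_smul]
      refine Finset.sum_congr rfl fun i _ => ?_
      rw [Submodule.coe_smul, algebra_compatible_smul K (c i), smul_smul]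
      simp [mul_div_assoc]
    have h4 : (∑ i, C (c i) * X ^ (i : ℕ) : k[X]) = 0 := by
      by_contra h0
      exact div_ne_zero (aeval_ne_zero_of_transcendental hm.transcendental h0) hy
        ((smul_eq_zero_iff_left hD).1 h3)
    have h5 := congrArg (fun q => coeff q (j : ℕ)) h4
    simpa [finsetSum_coeff, coeff_X_pow, Fin.val_inj] using h5
  have hspan : ⊤ ≤ Submodule.span k (Set.range v) := by
    rintro ⟨ω, hω⟩ -
    obtain ⟨P, hP, rfl⟩ := (hmem ω).1 hω
    have h1 : (⟨_, hω⟩ : regularDifferentials k t) = ∑ i : Fin g, P.coeff i • v i := by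
      apply Subtype.ext
      rw [Submodule.coe_sum]
      change (aeval t P / y) • KaehlerDifferential.D k K t = _
      rw [aeval_eq_sum_range' hP, Finset.sum_range, Finset.sum_div,
        Finset.sum_smul]
      refine Finset.sum_congr rfl fun i _ => ?_
      rw [Submodule.coe_smul, ← smul_assoc, smul_div_assoc]
    rw [h1]
    exact sum_mem fun i _ => Submodule.smul_mem _ _ (Submodule.subset_span ⟨i, rfl⟩)
  exact ⟨Module.Basis.mk hli hspan, fun j => by rw [Module.Basis.mk_apply]⟩

end IsQuadraticModel
-- The `p`-th iterate of a derivation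
section Iterate

variable {k K : Type*} [Field k] [Field K] [Algebra k K] (δ : Derivation k K K)

/-- In characteristic `p` the `p`-th iterate of a derivation satisfies the Leibniz rule. -/
theorem derivation_pow_char_leibniz (p : ℕ) [Fact p.Prime] [CharP k p] (a b : K) :
    ((δ : K →ₗ[k] K) ^ p : Module.End k K) (a * b) =
      a * ((δ : K →ₗ[k] K) ^ p : Module.End k K) b +
        b * ((δ : K →ₗ[k] K) ^ p : Module.End k K) a := by
  let d : Module.End k K := (δ : K →ₗ[k] K)
  -- Bracketing with `d` sends multiplication by `a` to multiplication by `d a`. Left and right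
  -- multiplication by `d` commute, so in characteristic `p` the `p`-th power of this bracket is the
  -- bracket with `d^p`.
  let ad : Module.End k (Module.End k K) := LinearMap.mulLeft k d - LinearMap.mulRight k d
  have had (a : K) : ad (LinearMap.mulLeft k a) = LinearMap.mulLeft k (d a) := by
    ext b
    simp [ad, d, mul_comm]
  have hadn (n : ℕ) : (ad ^ n) (LinearMap.mulLeft k a) = LinearMap.mulLeft k ((d ^ n) a) := by
    induction n with
    | zero => simp
    | succ n ih => rw [pow_succ', Module.End.mul_apply, ih, had, pow_succ', Module.End.mul_apply]
  have : CharP (Module.End k (Module.End k K)) p :=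
    charP_of_injective_algebraMap (algebraMap k (Module.End k (Module.End k K))).injective p
  have hp : ad ^ p = LinearMap.mulLeft k (d ^ p) - LinearMap.mulRight k (d ^ p) := by
    have hc : Commute (LinearMap.mulLeft k d : Module.End k (Module.End k K))
      (LinearMap.mulRight k d) := LinearMap.commute_mulLeft_right d d
    have h := sub_pow_char_of_commute (R := Module.End k (Module.End k K)) p hc
    rwa [LinearMap.pow_mulLeft, LinearMap.pow_mulRight] at h
  have h := LinearMap.congr_fun (hadn p) b
  rw [hp] at h
  simp only [LinearMap.sub_apply, LinearMap.mulLeft_apply, LinearMap.mulRight_apply,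
    Module.End.mul_apply] at h
  change (d ^ p) (a * b) = a * (d ^ p) b + b * (d ^ p) a
  linear_combination h

theorem derivation_pow_apply_pow {t : K} (ht : δ t = 1) (n : ℕ) :
    ((δ : K →ₗ[k] K) ^ n : Module.End k K) (t ^ n) = (n.factorial : K) := by
  induction n with
  | zero => simp
  | succ n ih =>
    have h1 : (δ : K →ₗ[k] K) (t ^ (n + 1)) = (n + 1) • t ^ n := by
      simp [Derivation.leibniz_pow, ht]
    rw [pow_succ, Module.End.mul_apply, h1, map_nsmul, ih, Nat.factorial_succ]
    push_cast
    simp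

end Iterate

/-! ### Cartier images of polynomial differentials -/

section CartierImage

variable {k K : Type*} [Field k] [Field K] [Algebra k K] {p : ℕ} {t : K}

theorem D_pow_char_mul [CharP k p] (u v : K) :
    KaehlerDifferential.D k K (u ^ p * v) = u ^ p • KaehlerDifferential.D k K v := by
  have : CharP K p := charP_of_injective_algebraMap (algebraMap k K).injective p
  rw [Derivation.leibniz, Derivation.leibniz_pow, ← Nat.cast_smul_eq_nsmul K, CharP.cast_eq_zero]
  simp

theorem IsCartierImage.add [Fact p.Prime] [CharP k p] {ω₁ ω₂ ω₁' ω₂' : Ω[K⁄k]}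
    (h₁ : IsCartierImage p t ω₁ ω₁') (h₂ : IsCartierImage p t ω₂ ω₂') :
    IsCartierImage p t (ω₁ + ω₂) (ω₁' + ω₂') := by
  have : CharP K p := charP_of_injective_algebraMap (algebraMap k K).injective p
  obtain ⟨φ₁, η₁, rfl, rfl⟩ := h₁
  obtain ⟨φ₂, η₂, rfl, rfl⟩ := h₂
  refine ⟨φ₁ + φ₂, η₁ + η₂, ?_, (add_smul _ _ _).symm⟩
  rw [add_pow_char, map_add, add_mul, add_smul]
  abel

theorem IsCartierImage.zero (hp : p ≠ 0) : IsCartierImage p t (0 : Ω[K⁄k]) 0 :=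
  ⟨0, 0, by simp [hp], by simp⟩

theorem IsCartierImage.smul [CharP k p] {ω ω' : Ω[K⁄k]} (h : IsCartierImage p t ω ω') (c : k) :
    IsCartierImage p t (c ^ p • ω) (c • ω') := by
  obtain ⟨φ, η, rfl, rfl⟩ := h
  refine ⟨c ^ p • φ, algebraMap k K c * η, ?_, ?_⟩
  · rw [smul_add, Derivation.map_smul, mul_pow, ← map_pow, mul_assoc, mul_smul (algebraMap k K _),
      algebraMap_smul]
  · rw [mul_smul, algebraMap_smul]

theorem IsCartierImage.sum [Fact p.Prime] [CharP k p] {ι : Type*} (s : Finset ι)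
    {ω ω' : ι → Ω[K⁄k]} (h : ∀ i ∈ s, IsCartierImage p t (ω i) (ω' i)) :
    IsCartierImage p t (∑ i ∈ s, ω i) (∑ i ∈ s, ω' i) := by
  classical
  induction s using Finset.induction_on with
  | empty => simpa using IsCartierImage.zero (Fact.out : p.Prime).ne_zero
  | insert i s hi ih =>
    rw [Finset.sum_insert hi, Finset.sum_insert hi]
    exact (h i (Finset.mem_insert_self i s)).add
      (ih fun j hj => h j (Finset.mem_insert_of_mem hj))

/-- `u ^ p q(t) dt` is exact when `q` has no monomials `X ^ n` with `p ∣ n + 1`. -/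
theorem isCartierImage_zero_of_coeff [Fact p.Prime] [CharP k p] (u : K) (q : k[X])
    (hq : ∀ n, p ∣ n + 1 → q.coeff n = 0) :
    IsCartierImage p t ((u ^ p * aeval t q) • KaehlerDifferential.D k K t) 0 := by
  have hp := (Fact.out : p.Prime)
  -- Termwise antiderivative; where `p ∣ n + 1` the division by zero is harmless, as that
  -- coefficient of `q` vanishes.
  let S : k[X] := ∑ n ∈ Finset.range (q.natDegree + 1), C (q.coeff n / (n + 1 : ℕ)) * X ^ (n + 1)
  have hS : derivative S = q := by
    conv_rhs => rw [q.as_sum_range_C_mul_X_pow]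
    rw [derivative_sum]
    refine Finset.sum_congr rfl fun n _ => ?_
    rw [derivative_C_mul_X_pow, Nat.add_sub_cancel]
    by_cases hn : p ∣ n + 1
    · simp [hq n hn]
    · have : ((n + 1 : ℕ) : k) ≠ 0 := by rwa [Ne, CharP.cast_eq_zero_iff k p]
      rw [div_mul_cancel₀ _ this]
  refine ⟨u ^ p * aeval t S, 0, ?_, by simp⟩
  rw [D_pow_char_mul, Derivation.map_aeval, hS, smul_smul, zero_pow hp.ne_zero, zero_mul, zero_smul,
    add_zero]

/-- The Cartier image of `u ^ p q(t) dt` for a polynomial `q`. -/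
theorem isCartierImage_of_natDegree_lt [Fact p.Prime] [CharP k p] (u : K) (q : k[X]) {g : ℕ}
    (hq : q.natDegree + 1 < p * (g + 1)) (r : Fin g → k)
    (hr : ∀ i, r i ^ p = q.coeff (p * (i + 1) - 1)) :
    IsCartierImage p t ((u ^ p * aeval t q) • KaehlerDifferential.D k K t)
      (∑ i, r i • (u * t ^ (i : ℕ)) • KaehlerDifferential.D k K t) := by
  have hp := (Fact.out : p.Prime)
  -- `q₁` collects the monomials of `q` without antiderivative. The degree bound excludes exponents
  -- `p(m+1)-1` with `m ≥ g`, so `q - q₁` is exact.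
  let q₁ : k[X] := ∑ i : Fin g, C (r i ^ p) * X ^ (p * ((i : ℕ) + 1) - 1)
  have hinj (i j : ℕ) (h : p * (i + 1) - 1 = p * (j + 1) - 1) : i = j := by
    have h1 : 0 < p * (i + 1) := Nat.mul_pos hp.pos (by omega)
    have h2 : 0 < p * (j + 1) := Nat.mul_pos hp.pos (by omega)
    have := Nat.eq_of_mul_eq_mul_left hp.pos (by omega : p * (i + 1) = p * (j + 1))
    omega
  have h0 : ∀ n, p ∣ n + 1 → (q - q₁).coeff n = 0 := by
    rintro n ⟨m, hm⟩
    obtain ⟨m, rfl⟩ : ∃ m', m = m' + 1 :=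
      Nat.exists_eq_succ_of_ne_zero (by rintro rfl; simp at hm)
    obtain rfl : n = p * (m + 1) - 1 := by omega
    rw [coeff_sub, sub_eq_zero, finsetSum_coeff]
    simp only [coeff_C_mul, coeff_X_pow]
    by_cases hmg : m < g
    · rw [Finset.sum_eq_single (⟨m, hmg⟩ : Fin g)]
      · simp [hr]
      · intro i _ hi
        rw [if_neg, mul_zero]
        exact fun h => hi (Fin.ext (hinj _ _ h).symm)
      · simp
    · rw [coeff_eq_zero_of_natDegree_lt, Finset.sum_eq_zero]
      · intro i _
        rw [if_neg, mul_zero]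
        intro h
        have := hinj _ _ h
        omega
      · have : p * (g + 1) ≤ p * (m + 1) := Nat.mul_le_mul_left p (by omega)
        omega
  have h1 : IsCartierImage p t ((u ^ p * aeval t q₁) • KaehlerDifferential.D k K t)
      (∑ i, r i • (u * t ^ (i : ℕ)) • KaehlerDifferential.D k K t) := by
    have : (u ^ p * aeval t q₁) • KaehlerDifferential.D k K t =
        ∑ i : Fin g, r i ^ p •
          ((u * t ^ (i : ℕ)) ^ p * t ^ (p - 1)) • KaehlerDifferential.D k K t := by
      rw [map_sum, Finset.mul_sum, Finset.sum_smul]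
      refine Finset.sum_congr rfl fun i _ => ?_
      rw [← algebraMap_smul K (r i ^ p), smul_smul]
      congr 1
      have : p * ((i : ℕ) + 1) - 1 = i * p + (p - 1) := by
        have := hp.pos
        rw [Nat.mul_succ, mul_comm]
        omega
      rw [this, map_mul, map_pow _ X, aeval_X, aeval_C, mul_pow, pow_add, pow_mul]
      ring
    rw [this]
    refine IsCartierImage.sum _ fun i _ => IsCartierImage.smul ⟨0, _, ?_, rfl⟩ _
    rw [map_zero, zero_add]
  have h2 := h1.add (isCartierImage_zero_of_coeff (t := t) u (q - q₁) h0)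
  rw [add_zero, ← add_smul, ← mul_add, ← map_add, add_sub_cancel] at h2
  exact h2

end CartierImage

/-! ### Uniqueness of the Cartier image, and its value on the basis -/

namespace IsQuadraticModel

variable {k K : Type*} [Field k] [Field K] [Algebra k K]
  {f : k[X]} {t y : K} {σ : K →ₐ[k] K}

theorem exists_derivation (hm : IsQuadraticModel f t y σ) (h2 : (2 : k) ≠ 0) (hf : f ≠ 0)
    [Algebra.EssFiniteType k K] : ∃ δ : Derivation k K K, δ t = 1 := by
  obtain ⟨φ, hφ⟩ := Module.Projective.exists_dual_ne_zero K (hm.D_ne_zero h2 hf)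
  refine ⟨(φ (KaehlerDifferential.D k K t))⁻¹ • φ.compDer (KaehlerDifferential.D k K), ?_⟩
  simp [hφ]

theorem derivation_eq_zero (hm : IsQuadraticModel f t y σ) (h2 : (2 : k) ≠ 0) (hf : f ≠ 0)
    (E : Derivation k K K) (hE : E t = 0) (u : K) : E u = 0 := by
  obtain ⟨v, hv⟩ := hm.exists_smul_D h2 hf (KaehlerDifferential.D k K u)
  have := congrArg E.liftKaehlerDifferential hv
  simpa [hE] using this

/-- `t ^ (p - 1) dt` is not exact. -/
theorem derivation_ne_neg_pow (hm : IsQuadraticModel f t y σ) (h2 : (2 : k) ≠ 0) (hf : f ≠ 0)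
    (p : ℕ) [Fact p.Prime] [CharP k p] (δ : Derivation k K K) (hδ : δ t = 1) (ψ : K) :
    δ ψ ≠ -t ^ (p - 1) := by
  intro hψ
  have hp := (Fact.out : p.Prime)
  have : CharP K p := charP_of_injective_algebraMap (algebraMap k K).injective p
  -- `E = δ^p` is a derivation killing `t`, hence zero. But `δ ψ = -t^(p-1)` would give `E ψ =
  -- -(p-1)!`, which is nonzero in characteristic `p`.
  let E : Derivation k K K := Derivation.mk' ((δ : K →ₗ[k] K) ^ p : Module.End k K)
    (fun a b => derivation_pow_char_leibniz δ p a b)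
  have hpow (u : K) : E u = ((δ : K →ₗ[k] K) ^ (p - 1) : Module.End k K) (δ u) := by
    change ((δ : K →ₗ[k] K) ^ p : Module.End k K) u = _
    obtain ⟨n, hn⟩ := Nat.exists_eq_succ_of_ne_zero hp.ne_zero
    rw [hn, Nat.succ_sub_one, pow_succ, Module.End.mul_apply]
    rfl
  have hEt : E t = 0 := by
    rw [hpow, hδ]
    obtain ⟨n, hn⟩ := Nat.exists_eq_succ_of_ne_zero (Nat.sub_ne_zero_of_lt hp.one_lt)
    rw [hn, pow_succ, Module.End.mul_apply]
    simp
  have h := hm.derivation_eq_zero h2 hf E hEt ψ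
  rw [hpow, hψ, map_neg, derivation_pow_apply_pow δ hδ, neg_eq_zero,
    CharP.cast_eq_zero_iff K p, hp.dvd_factorial] at h
  have := hp.pos
  omega

/-- If `η₁ ≠ η₂`, dividing the difference of the two decompositions by `(η₁ - η₂)^p`, a constant for
`d`, would make `-t^(p-1) dt` exact. -/
theorem isCartierImage_unique (hm : IsQuadraticModel f t y σ) (h2 : (2 : k) ≠ 0) (hf : f ≠ 0)
    [Algebra.EssFiniteType k K] (p : ℕ) [Fact p.Prime] [CharP k p] {ω ω₁ ω₂ : Ω[K⁄k]}
    (h₁ : IsCartierImage p t ω ω₁) (h₂ : IsCartierImage p t ω ω₂) : ω₁ = ω₂ := by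
  have : CharP K p := charP_of_injective_algebraMap (algebraMap k K).injective p
  obtain ⟨φ₁, η₁, rfl, rfl⟩ := h₁
  obtain ⟨φ₂, η₂, h, rfl⟩ := h₂
  obtain ⟨δ, hδ⟩ := hm.exists_derivation h2 hf
  by_contra hne
  have hη : η₁ - η₂ ≠ 0 := fun h0 => hne (by rw [sub_eq_zero.1 h0])
  have hD : KaehlerDifferential.D k K (((η₁ - η₂)⁻¹) ^ p * (φ₁ - φ₂)) =
      (-t ^ (p - 1)) • KaehlerDifferential.D k K t := by
    have h3 : KaehlerDifferential.D k K (φ₁ - φ₂) =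
        (-((η₁ - η₂) ^ p * t ^ (p - 1))) • KaehlerDifferential.D k K t := by
      rw [sub_pow_char, map_sub, sub_eq_iff_eq_add, ← add_left_inj, h, add_right_comm, ← add_smul,
        add_comm]
      congr 2
      ring
    rw [D_pow_char_mul, h3, smul_smul, inv_pow]
    congr 1
    field_simp
  have := congrArg δ.liftKaehlerDifferential hD
  simp only [map_smul, Derivation.liftKaehlerDifferential_comp_D, hδ, smul_eq_mul, mul_one] at this
  exact hm.derivation_ne_neg_pow h2 hf p δ hδ _ this

/-- The Cartier image of `t ^ j dt / y` on a hyperelliptic curve of genus `g`. -/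
theorem isCartierImage_pow_div (hm : IsQuadraticModel f t y σ) (hf : f ≠ 0)
    {p : ℕ} [Fact p.Prime] [CharP k p] (hp2 : p ≠ 2) {g : ℕ} (hdeg : f.natDegree ≤ 2 * (g + 1))
    (j : Fin g) (r : Fin g → k)
    (hr : ∀ i, r i ^ p = (f ^ ((p - 1) / 2) * X ^ (j : ℕ)).coeff (p * (i + 1) - 1)) :
    IsCartierImage p t ((t ^ (j : ℕ) / y) • KaehlerDifferential.D k K t)
      (∑ i : Fin g, r i • (t ^ (i : ℕ) / y) • KaehlerDifferential.D k K t) := by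
  have hy := hm.y_ne_zero hf
  obtain ⟨m, hpm⟩ := (Fact.out : p.Prime).odd_of_ne_two hp2
  have hm2 : (p - 1) / 2 = m := by omega
  rw [hm2] at hr
  have h := isCartierImage_of_natDegree_lt (t := t) y⁻¹ (f ^ m * X ^ (j : ℕ)) (g := g) ?_ r hr
  · convert h using 2
    · rw [map_mul, map_pow, map_pow, aeval_X, ← hm.sq_eq, ← pow_mul, inv_pow, hpm, pow_succ]
      field_simp
    · rw [div_eq_inv_mul]
  · have h1 : (f ^ m * X ^ (j : ℕ)).natDegree ≤ m * (2 * (g + 1)) + j := by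
      refine natDegree_mul_le.trans (add_le_add ?_ (natDegree_X_pow_le _))
      exact natDegree_pow_le.trans (Nat.mul_le_mul_left m hdeg)
    -- The required bound reduces exactly to `j < g`.
    have h3 : p * (g + 1) = m * (2 * (g + 1)) + g + 1 := by rw [hpm]; ring
    have := j.2
    omega

end IsQuadraticModel
-- The Cartier operator and its matrix
section Matrix

variable {k K : Type*} [Field k] [Field K] [Algebra k K]
  {f : k[X]} {t y : K} {σ : K →ₐ[k] K}

theorem IsQuadraticModel.existsUnique_isCartierImage (hm : IsQuadraticModel f t y σ)
    (h2 : (2 : k) ≠ 0) (hf : f ≠ 0) [Algebra.EssFiniteType k K] [IsAlgClosed k]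
    {p : ℕ} [Fact p.Prime] [CharP k p] (hp2 : p ≠ 2) {g : ℕ} (hdeg : f.natDegree ≤ 2 * (g + 1))
    (A : Module.Basis (Fin g) k (regularDifferentials k t))
    (hA : ∀ j, (A j : Ω[K⁄k]) = (t ^ (j : ℕ) / y) • KaehlerDifferential.D k K t)
    (ω : regularDifferentials k t) :
    ∃! ω' : regularDifferentials k t, IsCartierImage p t (ω : Ω[K⁄k]) ω' := by
  have hp := (Fact.out : p.Prime)
  -- `r` picks `p`-th roots: the operator is `p⁻¹`-linear, so coordinates enter through their roots.
  choose r hr using fun c : k => IsAlgClosed.exists_pow_nat_eq c hp.pos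
  refine existsUnique_of_exists_of_unique
    ⟨∑ j, r (A.repr ω j) • ∑ i : Fin g,
      r ((f ^ ((p - 1) / 2) * X ^ (j : ℕ)).coeff (p * (i + 1) - 1)) • A i, ?_⟩
    fun ω₁ ω₂ h₁ h₂ => Subtype.ext (hm.isCartierImage_unique h2 hf p h₁ h₂)
  have h := IsCartierImage.sum Finset.univ fun j _ =>
    (hm.isCartierImage_pow_div hf hp2 hdeg j _ fun i => hr _).smul (r (A.repr ω j))
  conv_lhs => rw [← A.sum_repr ω]
  simp only [Submodule.coe_sum, Submodule.coe_smul, hA]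
  simpa only [hr] using h

/-- The entries of the Cartier-Manin matrix of `y ^ 2 = f(x)` are coefficients of
`f ^ ((p - 1) / 2)`. -/
theorem IsQuadraticModel.cartierManinMatrix_apply (hm : IsQuadraticModel f t y σ)
    (h2 : (2 : k) ≠ 0) (hf : f ≠ 0) [Algebra.EssFiniteType k K] [IsAlgClosed k]
    {p : ℕ} [Fact p.Prime] [CharP k p] (hp2 : p ≠ 2) {g : ℕ} (hdeg : f.natDegree ≤ 2 * (g + 1))
    (A : Module.Basis (Fin g) k (regularDifferentials k t))
    (hA : ∀ j, (A j : Ω[K⁄k]) = (t ^ (j : ℕ) / y) • KaehlerDifferential.D k K t) (i j : Fin g) :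
    cartierManinMatrix p t A i j =
      (f ^ ((p - 1) / 2) * X ^ (j : ℕ)).coeff (p * (i + 1) - 1) := by
  have hp := (Fact.out : p.Prime)
  choose r hr using fun c : k => IsAlgClosed.exists_pow_nat_eq c hp.pos
  have h1 := hm.isCartierImage_pow_div hf hp2 hdeg j _ fun i => hr _
  have h3 := Classical.epsilon_spec
    (hm.existsUnique_isCartierImage h2 hf hp2 hdeg A hA (A j)).exists
  have h4 : cartierOperator p t (A j) =
      ∑ i : Fin g, r ((f ^ ((p - 1) / 2) * X ^ (j : ℕ)).coeff (p * (i + 1) - 1)) • A i := by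
    refine Subtype.ext (hm.isCartierImage_unique h2 hf p h3 ?_)
    simpa only [Submodule.coe_sum, Submodule.coe_smul, hA] using h1
  rw [cartierManinMatrix, Matrix.of_apply, h4, A.repr_sum_self, hr]

end Matrix

/-! ### The family `f_{a,b}` -/

section Family

variable {k : Type*} [Field k]

theorem natDegree_fab_le (a b : k) : (fab a b).natDegree ≤ 10 := by
  unfold fab
  compute_degree

theorem fab_eq (a b : k) :
    fab a b = X * expand k 3 (X ^ 3 + X ^ 2 + C a * X + C b) := by
  simp only [fab, map_add, map_mul, map_pow, expand_X, expand_C]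
  ring

theorem coeff_fab_pow_eq_zero (a b : k) {m n : ℕ} (h : ¬ n ≡ m [MOD 3]) :
    (fab a b ^ m).coeff n = 0 := by
  rw [fab_eq, mul_pow, ← map_pow, coeff_X_pow_mul']
  split_ifs with hmn
  · rw [coeff_expand three_pos, if_neg]
    exact fun h3 => h ((Nat.modEq_iff_dvd' hmn).2 h3).symm
  · rfl

theorem aeval_fab_eq {K : Type*} [Field K] [Algebra k K] (a b : k) {t : K} (ht : t ≠ 0) :
    aeval t (fab a b) = t ^ (2 * (4 + 1)) *
      aeval t⁻¹ (1 + X ^ 3 + C a * X ^ 6 + C b * X ^ 9 : k[X]) := by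
  simp only [fab, map_add, map_mul, map_pow, aeval_X, aeval_C, map_one]
  field_simp
  ring

/-- A common root `z` of the reciprocal polynomial `h` and `h'` is nonzero. Differentiating `f(t) =
t^10 h(1/t)` expresses `f'(1/z)` through `h(z)` and `h'(z)`, so `1/z` would be a multiple root of
`f`. -/
theorem separable_reciprocal_fab [IsAlgClosed k] (a b : k) (h : (fab a b).Separable) :
    (1 + X ^ 3 + C a * X ^ 6 + C b * X ^ 9 : k[X]).Separable := by
  rw [separable_def, isCoprime_iff_aeval_ne_zero_of_isAlgClosed k k] at h ⊢
  intro z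
  by_contra! hz
  obtain ⟨h1, h3⟩ := hz
  have hz0 : z ≠ 0 := by
    rintro rfl
    simp at h1
  have h4 : aeval z⁻¹ (fab a b) = 0 := by
    rw [aeval_fab_eq a b (inv_ne_zero hz0), inv_inv, h1, mul_zero]
  have h5 : aeval z⁻¹ (derivative (fab a b)) = 0 := by
    simp [fab, -map_add, -map_mul] at h1 h3 ⊢
    field_simp
    linear_combination 10 * h1 - z * h3
  exact (h z⁻¹).elim (fun h => h h4) fun h => h h5

end Family

end HyperellipticCurve

open HyperellipticCurve in
theorem lemma3p1 (p : ℕ) (hp : p.Prime) (hp7 : 7 ≤ p)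
    {k : Type*} [Field k] [IsAlgClosed k] [CharP k p]
    (a b : k) (hsep : (fab a b).Separable)
    -- `K` is the function field of the curve `y ^ 2 = f_{a,b}(x)`
    (K : Type*) [Field K] [Algebra k K] [Algebra (CoordinateRing (fab a b)) K]
    [IsScalarTower k (CoordinateRing (fab a b)) K] [IsFractionRing (CoordinateRing (fab a b)) K]
    (x y : K) (hx : x = xFun (fab a b) K) (hy : y = yFun (fab a b) K)
    (c : ℕ → k) (hc : ∀ n, c n = (fab a b ^ ((p - 1) / 2)).coeff n) :
    -- the Cartier operator is well defined on the regular differential forms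
    (∀ ω : regularDifferentials k x, ∃! ω' : regularDifferentials k x,
      IsCartierImage p x (ω : Ω[K⁄k]) ω') ∧
    -- the forms `x ^ (j - 1) dx / y`, `1 ≤ j ≤ 4`, are a basis of the regular differential forms,
    -- and the Cartier-Manin matrix with respect to it has the given shape
    ∃ A : Module.Basis (Fin 4) k (regularDifferentials k x),
      (∀ j, (A j : Ω[K⁄k]) = (x ^ (j : ℕ) / y) • KaehlerDifferential.D k K x) ∧
      (p ≡ 1 [MOD 3] →
        cartierManinMatrix p x A =
          !![c (p - 1),     0,               0,               c (p - 4);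
             0,             c (2 * p - 2),   0,               0;
             0,             0,               c (3 * p - 3),   0;
             c (4 * p - 1), 0,               0,               c (4 * p - 4)]) ∧
      (p ≡ 2 [MOD 3] →
        cartierManinMatrix p x A =
          !![0,             0,               c (p - 3),       0;
             0,             c (2 * p - 2),   0,               0;
             c (3 * p - 1), 0,               0,               c (3 * p - 4);
             0,             0,               c (4 * p - 3),   0]) := by
  have : Fact p.Prime := ⟨hp⟩
  have hp2 : p ≠ 2 := by omega
  have h2 : (2 : k) ≠ 0 := by
    have := CharP.cast_eq_zero_iff k p 2
    intro h0
    have := Nat.le_of_dvd two_pos (this.1 (by exact_mod_cast h0))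
    omega
  have hess : Algebra.EssFiniteType k K := essFiniteType (fab a b) K
  obtain ⟨σ, hm⟩ := exists_isQuadraticModel (fab a b) K
  rw [← hx, ← hy] at hm
  have hf := hsep.ne_zero
  have hdeg : (fab a b).natDegree ≤ 2 * (4 + 1) := natDegree_fab_le a b
  obtain ⟨A, hA⟩ := hm.exists_basis h2 hsep (separable_reciprocal_fab a b hsep) four_pos
    (aeval_fab_eq a b hm.t_ne_zero)
  -- The factor `X ^ j` shifts the index `p(i+1)-1` down by `j`; the subtraction does not truncate,
  -- since `j ≤ 3` and `p ≥ 7`.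
  have hM (i j : Fin 4) : cartierManinMatrix p x A i j = c (p * (i + 1) - (j + 1)) := by
    rw [hm.cartierManinMatrix_apply h2 hf hp2 hdeg A hA, coeff_mul_X_pow', hc, if_pos,
      Nat.sub_sub, add_comm 1]
    have : p ≤ p * (i + 1) := Nat.le_mul_of_pos_right p (by omega)
    omega
  have hodd := hp.odd_of_ne_two hp2
  have h0 {n : ℕ} (hn : ¬ n ≡ (p - 1) / 2 [MOD 3]) : c n = 0 := by
    rw [hc, coeff_fab_pow_eq_zero a b hn]
  obtain ⟨m, hpm⟩ := hodd
  refine ⟨hm.existsUnique_isCartierImage h2 hf hp2 hdeg A hA, A, hA, fun hp3 => ?_, fun hp3 => ?_⟩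
  -- With zero-based indices, `p(i+1)-(j+1) ≡ (p-1)/2` mod 3 means `i ≡ j` if `p ≡ 1`, and `i + j ≡
  -- 2` if `p ≡ 2`. All other entries vanish by `h0`.
  all_goals
    unfold Nat.ModEq at hp3 h0
    ext i j
    rw [hM]
    fin_cases i <;> fin_cases j <;>
      first
      | exact h0 (by simp only [Fin.reduceFinMk, Fin.val_zero]; omega)
      | exact congrArg c (by simp <;> omega)
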